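/- Let $k\ge 1$ be an integer and let $H_k=\sum_{j=1}^k 1/j$. In the time-optimal $k$-server problem on a metric space $(M,d)$, an instance $I$ consists of an initial configuration $C_0\colon\{1,\dots,k\}\to M$ of the $k$ servers and a finite sequence of requests $r_1,\dots,r_n\in M$; a solution is a sequence of configurations $C_1,\dots,C_n\colon\{1,\dots,k\}\to M$ such that $r_j\in C_j(\{1,\dots,k\})$ for every $j$, and its cost is $\sum_{j=1}^n\max_{1\le i\le k} d(C_{j-1}(i),C_j(i))$. Let $\mathrm{OPT}(I)$ be the minimum cost of a solution of $I$. A deterministic online algorithm computes a solution in which $C_j$ depends only on $C_0$ and $r_1,\dots,r_j$. A randomized online algorithm is a random variable whose values are deterministic online algorithms; it is $c$-competitive in expectation if there is a constant $\alpha$ such that on every instance $I$ its expected cost is at most $c\cdot\mathrm{OPT}(I)+\alpha$. Then no randomized online algorithm for the time-optimal $k$-server problem has a better expected competitive ratio than $k+H_k-1$. More precisely, for every real $c<k+H_k-1$ there is a finite connected unweighted undirected graph such that no randomized online algorithm for the time-optimal $k$-server problem on its vertex set, with the shortest-path metric, is $c$-competitive in expectation. -/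

import Mathlib

open MeasureTheory

universe u v

namespace KServer

/-- A `k`-configuration in `M`: server `i` is at the point `C i`. -/
abbrev Config (M : Type u) (k : ℕ) : Type u := Fin k → M

/-- The configuration `C` covers the point `p`, i.e. some server is at `p`. -/
def Covers {M : Type u} {k : ℕ} (C : Config M k) (p : M) : Prop := ∃ i, C i = p

/-- An instance of the `k`-server problem on `M`: an initial configuration `C₀` and a finite
sequence of requests `r₁, …, rₙ`. -/
structure ServerInstance (M : Type u) (k : ℕ) where
  init : Config M k
  requests : List M

/-- A solution of an instance is a sequence of configurations `C₁, …, Cₙ`, of the same length as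
the request sequence, such that `Cⱼ` covers `rⱼ` for every `j`. -/
def IsSolution {M : Type u} {k : ℕ} (I : ServerInstance M k) (S : List (Config M k)) : Prop :=
  List.Forall₂ Covers S I.requests

section Cost

variable {M : Type u} [MetricSpace M] {k : ℕ}

/-- Cost of one step in the time model: the maximum distance travelled by a server. -/
noncomputable def stepCost (C C' : Config M k) : ℝ := ⨆ i, dist (C i) (C' i)

/-- Time-model cost `∑ⱼ maxᵢ d(Cⱼ₋₁(i), Cⱼ(i))` of a sequence `C₁, …, Cₙ` of configurations,
started in the configuration `C₀` given as the first argument. -/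
noncomputable def cost : Config M k → List (Config M k) → ℝ
  | _, [] => 0
  | C₀, C :: S => stepCost C₀ C + cost C S

/-- The optimal (offline) cost of an instance: the infimum of the costs of its solutions. -/
noncomputable def optCost (I : ServerInstance M k) : ℝ :=
  sInf {t : ℝ | ∃ S, IsSolution I S ∧ cost I.init S = t}

end Cost

/-- A deterministic online algorithm for the `k`-server problem on `M`. Its answer to a request is
a configuration covering the request; it may depend only on the initial configuration, the list of
the past requests, and the current request. -/
structure OnlineAlgorithm (M : Type u) (k : ℕ) where
  answer : Config M k → List M → M → Config M k
  covers : ∀ C₀ past x, Covers (answer C₀ past x) x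

namespace OnlineAlgorithm

variable {M : Type u} {k : ℕ}

/-- The answers to the remaining requests, after the requests in `past` have been served. -/
def runFrom (A : OnlineAlgorithm M k) (C₀ : Config M k) : List M → List M → List (Config M k)
  | _, [] => []
  | past, x :: rest => A.answer C₀ past x :: A.runFrom C₀ (past ++ [x]) rest

/-- The solution computed by the algorithm on an instance. -/
def run (A : OnlineAlgorithm M k) (I : ServerInstance M k) : List (Config M k) :=
  A.runFrom I.init [] I.requests

theorem isSolution_run (A : OnlineAlgorithm M k) (I : ServerInstance M k) :
    IsSolution I (A.run I) := by
  have h : ∀ (rest past : List M),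
      List.Forall₂ Covers (A.runFrom I.init past rest) rest := by
    intro rest
    induction rest with
    | nil => intro past; exact List.Forall₂.nil
    | cons x rest ih => intro past; exact List.Forall₂.cons (A.covers _ _ _) (ih _)
  exact h _ _

end OnlineAlgorithm

/-- A randomized online algorithm for the `k`-server problem on `M`: a random deterministic online
algorithm, the randomness (the "random tape") being an outcome in an arbitrary probability space,
such that each answer is a random variable. -/
structure RandomizedOnlineAlgorithm (M : Type u) [MetricSpace M] (k : ℕ) where
  Ω : Type v
  mΩ : MeasurableSpace Ω
  P : Measure Ω
  isProb : IsProbabilityMeasure P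
  alg : Ω → OnlineAlgorithm M k
  stronglyMeasurable_answer : ∀ C₀ past x,
    StronglyMeasurable fun ω => (alg ω).answer C₀ past x

/-- `R` is `c`-competitive in expectation (for the time model): there is a constant `α` such that on
every instance the expected cost is finite and at most `c` times the optimal cost plus `α`. -/
def RandomizedOnlineAlgorithm.IsCompetitiveInExpectation {M : Type u} [MetricSpace M] {k : ℕ}
    (R : RandomizedOnlineAlgorithm.{u, v} M k) (c : ℝ) : Prop :=
  letI := R.mΩ
  ∃ α : ℝ, ∀ I : ServerInstance M k,
    Integrable (fun ω => cost I.init ((R.alg ω).run I)) R.P ∧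
      (∫ ω, cost I.init ((R.alg ω).run I) ∂(R.P)) ≤ c * optCost I + α

end KServer

/-!
The lower bound is an instance of Yao's principle: on a suitable graph there is a random request
sequence of `m` phases such that the optimal cost is always at most `m`, whereas every deterministic
online algorithm pays at least `k + H_k - 1 - ε` per phase on average.

In a phase, `k` new points are requested one after the other, given `k` old points, which are the
new points of the previous phase. All new points can be reached by moving every server from its old
point along a single edge, so that the optimal solution pays `1` per phase by moving all servers at
once. The first new point is adjacent to all old points and reveals nothing. Each later one is
adjacent to only one of the old points, its origin, which is random among those that have not been
used yet; with high probability, all other servers are at distance at least `2` from it. Repeating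
the requests forces an online algorithm to cover all new points requested so far. When the new point
with index `j ≥ 1` (counting from `0`) is requested, at most `k - j` servers are left at the old
points, while there are `k - j + 1` possible origins. Hence with probability at least
`1 / (k - j + 1)` there is no server at the origin and serving the request costs `2` instead of `1`.
Together, the phase costs at least `k + ∑_{j=1}^{k-1} 1 / (k - j + 1) = k + H_k - 1`, up to an
error.

For a finite graph on which this can be repeated forever, take `2 k` columns on two sides, which
host the old and new points alternately, and let a vertex be a column together with a label in
`{0, …, q}` for each column. Vertices `(c, f)` and `(d, g)` are adjacent if `f d = g c`. A new point
can then be made adjacent to prescribed old points, as these lie in different columns, and a random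
choice of its other labels makes it adjacent to any given vertex in another column than its origin
with probability `1 / (q + 1)` only (`PhaseState.le_serveCost`, `PhaseState.gain_le_expect`).

An online algorithm may temporarily leave some of the points uncovered. This is dealt with by an
induction on the number of remaining requests (`PhaseState.target_le_average`), in which the current
configuration is compared with arbitrary configurations that do cover all of the points. The bound
on the optimal cost is `PhaseState.exists_solution`.
-/

namespace KServer

/-! ### Costs in a metric space -/

section Cost

variable {M : Type u} [MetricSpace M] {k : ℕ}

theorem dist_le_stepCost (C C' : Config M k) (i : Fin k) : dist (C i) (C' i) ≤ stepCost C C' :=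
  le_ciSup (f := fun i => dist (C i) (C' i)) (Set.finite_range _).bddAbove i

theorem stepCost_le {C C' : Config M k} {a : ℝ} (ha : 0 ≤ a) (h : ∀ i, dist (C i) (C' i) ≤ a) :
    stepCost C C' ≤ a :=
  Real.iSup_le h ha

theorem stepCost_nonneg (C C' : Config M k) : 0 ≤ stepCost C C' :=
  Real.iSup_nonneg fun _ => dist_nonneg

@[simp]
theorem stepCost_self (C : Config M k) : stepCost C C = 0 := by
  simp [stepCost]

theorem stepCost_triangle (C D E : Config M k) : stepCost C E ≤ stepCost C D + stepCost D E :=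
  stepCost_le (add_nonneg (stepCost_nonneg _ _) (stepCost_nonneg _ _)) fun i =>
    (dist_triangle _ (D i) _).trans
      (add_le_add (dist_le_stepCost C D i) (dist_le_stepCost D E i))

theorem cost_nonneg (C : Config M k) (S : List (Config M k)) : 0 ≤ cost C S := by
  induction S generalizing C with
  | nil => exact le_rfl
  | cons D S ih => exact add_nonneg (stepCost_nonneg _ _) (ih D)

theorem cost_append (C : Config M k) (S T : List (Config M k)) :
    cost C (S ++ T) = cost C S + cost (S.getLastD C) T := by
  induction S generalizing C with
  | nil => simp [cost]
  | cons D S ih => simp only [List.cons_append, cost, ih, List.getLastD_cons]; ring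

theorem stepCost_getLastD_le_cost (C : Config M k) (S : List (Config M k)) :
    stepCost C (S.getLastD C) ≤ cost C S := by
  induction S generalizing C with
  | nil => simp [cost]
  | cons D S ih =>
    rw [List.getLastD_cons, cost]
    exact (stepCost_triangle C D _).trans (by gcongr; exact ih D)

theorem cost_replicate_append_le (C D : Config M k) (n : ℕ) (S : List (Config M k)) :
    cost C (List.replicate n D ++ S) ≤ stepCost C D + cost D S := by
  induction n generalizing C with
  | zero =>
    cases S with
    | nil => simpa [cost] using stepCost_nonneg C D
    | cons E S =>
      have := stepCost_triangle C D E
      simp only [List.replicate_zero, List.nil_append, cost]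
      linarith
  | succ n ih =>
    have := ih D
    rw [stepCost_self] at this
    simp only [List.replicate_succ, List.cons_append, cost]
    linarith

theorem optCost_nonneg (I : ServerInstance M k) : 0 ≤ optCost I := by
  apply Real.sInf_nonneg
  rintro _ ⟨S, -, rfl⟩
  exact cost_nonneg _ _

theorem optCost_le {I : ServerInstance M k} {S : List (Config M k)} (hS : IsSolution I S) :
    optCost I ≤ cost I.init S := by
  apply csInf_le
  · refine ⟨0, ?_⟩
    rintro _ ⟨S, -, rfl⟩
    exact cost_nonneg _ _
  · exact ⟨S, hS, rfl⟩

theorem covers_or_one_le_cost (hsep : ∀ x y : M, x ≠ y → 1 ≤ dist x y) {C : Config M k}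
    {S : List (Config M k)} {L : List M} (h : List.Forall₂ Covers S L) :
    (∀ p ∈ L, Covers C p) ∨ 1 ≤ cost C S := by
  induction h generalizing C with
  | nil => simp
  | @cons D p S L hp _ ih =>
    by_cases hCD : C = D
    · subst hCD
      rcases ih (C := C) with h | h
      · left; simpa [hp] using h
      · right
        simpa [cost] using h
    · right
      obtain ⟨i, hi⟩ := Function.ne_iff.1 hCD
      have := hsep _ _ hi
      have := dist_le_stepCost C D i
      have := cost_nonneg D S
      rw [cost]
      linarith

/-- Serving `N` rounds of requests to the points of `L` forces the servers to cover all of `L`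
simultaneously at some time, unless at least `N` is paid: a round in which no server moves is
served by a configuration covering `L`, and any other round costs at least `1`. -/
theorem exists_covering_or_le_cost (hsep : ∀ x y : M, x ≠ y → 1 ≤ dist x y) (L : List M) (N : ℕ)
    {C : Config M k} {S : List (Config M k)}
    (h : List.Forall₂ Covers S (List.replicate N L).flatten) :
    (∃ D : Config M k, (∀ p ∈ L, Covers D p) ∧
      stepCost C D + stepCost D (S.getLastD C) ≤ cost C S) ∨ (N : ℝ) ≤ cost C S := by
  induction N generalizing C S with
  | zero => right; simpa using cost_nonneg C S
  | succ N ih =>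
    rw [List.replicate_succ, List.flatten_cons] at h
    have h1 := List.forall₂_take_append _ _ _ h
    have h2 := List.forall₂_drop_append _ _ _ h
    obtain ⟨S₁, S₂, rfl, h1, h2⟩ : ∃ S₁ S₂, S = S₁ ++ S₂ ∧ List.Forall₂ Covers S₁ L ∧
        List.Forall₂ Covers S₂ (List.replicate N L).flatten :=
      ⟨_, _, (List.take_append_drop _ _).symm, h1, h2⟩
    rcases covers_or_one_le_cost hsep (C := C) h1 with hC | hC
    · exact Or.inl ⟨C, hC, by simpa using stepCost_getLastD_le_cost C (S₁ ++ S₂)⟩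
    · rw [cost_append]
      have hlast : (S₁ ++ S₂).getLastD C = S₂.getLastD (S₁.getLastD C) := by
        clear * -
        induction S₁ generalizing C with
        | nil => rfl
        | cons D S ih => simp only [List.cons_append, List.getLastD_cons, ih]
      rw [hlast]
      rcases ih (C := S₁.getLastD C) h2 with ⟨D, hD, hcost⟩ | hcost
      · refine Or.inl ⟨D, hD, ?_⟩
        have h3 := stepCost_triangle C (S₁.getLastD C) D
        have h4 := stepCost_getLastD_le_cost C S₁
        linarith
      · right
        push_cast
        linarith

end Cost

theorem OnlineAlgorithm.runFrom_append {M : Type u} {k : ℕ} (A : OnlineAlgorithm M k)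
    (C₀ : Config M k) (past l l' : List M) :
    A.runFrom C₀ past (l ++ l') = A.runFrom C₀ past l ++ A.runFrom C₀ (past ++ l) l' := by
  induction l generalizing past with
  | nil => simp [runFrom]
  | cons x l ih => simp [runFrom, ih]

theorem OnlineAlgorithm.forall₂_covers_runFrom {M : Type u} {k : ℕ} (A : OnlineAlgorithm M k)
    (C₀ : Config M k) (past l : List M) : List.Forall₂ Covers (A.runFrom C₀ past l) l := by
  induction l generalizing past with
  | nil => exact List.Forall₂.nil
  | cons x l ih => exact List.Forall₂.cons (A.covers _ _ _) (ih _)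

/-! ### The graph -/

/-- The columns of the graph: two sides with `k` columns each. -/
abbrev Column (k : ℕ) : Type := Bool × Fin k

/-- A vertex of the graph lies in a column and carries a label in `{0, …, q}` for every column. -/
@[ext]
structure Vertex (k q : ℕ) where
  col : Column k
  label : Column k → Fin (q + 1)

namespace Vertex

variable {k q : ℕ}

/-- Two vertices are close if each carries the same label for the other one's column. Distinct
vertices are going to be adjacent if and only if they are close. -/
def Close (v w : Vertex k q) : Prop := v.label w.col = w.label v.col

theorem Close.symm {v w : Vertex k q} (h : v.Close w) : w.Close v := Eq.symm h

instance : Finite (Vertex k q) :=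
  Finite.of_injective (fun v => (v.col, v.label)) fun v w h => by
    ext1
    · exact congrArg Prod.fst h
    · exact congrArg Prod.snd h

/-- The graph in which distinct close vertices are adjacent. -/
def graph (k q : ℕ) : SimpleGraph (Vertex k q) where
  Adj v w := v ≠ w ∧ v.Close w
  symm := ⟨fun _ _ h => ⟨h.1.symm, h.2.symm⟩⟩
  loopless := ⟨fun _ h => h.1 rfl⟩

theorem Close.reachable {v w : Vertex k q} (h : v.Close w) : (graph k q).Reachable v w := by
  by_cases hvw : v = w
  · rw [hvw]
  · exact SimpleGraph.Adj.reachable ⟨hvw, h⟩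

theorem reachable_of_col_ne {v w : Vertex k q} (h : v.col ≠ w.col) :
    (graph k q).Reachable v w := by
  -- Change the label of `v` for the column of `w`, staying in the column of `v`.
  let z : Vertex k q := ⟨v.col, Function.update v.label w.col (w.label v.col)⟩
  have hz : v.Close z := by simp [Close, z, Function.update_of_ne h]
  have hw : z.Close w := by simp [Close, z]
  exact hz.reachable.trans hw.reachable

theorem connected_graph [NeZero k] : (graph k q).Connected := by
  have : Nonempty (Vertex k q) := ⟨⟨(false, 0), 0⟩⟩
  refine ⟨fun v w => ?_⟩
  by_cases h : v.col = w.col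
  · let z : Vertex k q := ⟨(!v.col.1, v.col.2), 0⟩
    have hv : v.col ≠ z.col := fun h => by simpa [z] using congrArg Prod.fst h
    exact (reachable_of_col_ne hv).trans (reachable_of_col_ne (h ▸ hv.symm))
  · exact reachable_of_col_ne h

noncomputable instance [NeZero k] : MetricSpace (Vertex k q) where
  dist v w := ((graph k q).dist v w : ℝ)
  dist_self v := by simp
  dist_comm v w := by rw [SimpleGraph.dist_comm]
  dist_triangle u v w := by exact_mod_cast connected_graph.dist_triangle
  eq_of_dist_eq_zero h := connected_graph.dist_eq_zero_iff.1 (by exact_mod_cast h)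

theorem dist_eq [NeZero k] (v w : Vertex k q) : dist v w = ((graph k q).dist v w : ℝ) := rfl

theorem one_le_dist [NeZero k] {v w : Vertex k q} (h : v ≠ w) : 1 ≤ dist v w := by
  rw [dist_eq]
  exact_mod_cast connected_graph.pos_dist_of_ne h

theorem two_le_dist [NeZero k] {v w : Vertex k q} (h : ¬ v.Close w) : 2 ≤ dist v w := by
  have hne : v ≠ w := by rintro rfl; exact h rfl
  rw [dist_eq]
  exact_mod_cast connected_graph.one_lt_dist_of_ne_of_not_adj hne fun h' => h h'.2

theorem Close.dist_le_one [NeZero k] {v w : Vertex k q} (h : v.Close w) : dist v w ≤ 1 := by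
  by_cases hvw : v = w
  · simp [hvw]
  · have hadj : (graph k q).Adj v w := ⟨hvw, h⟩
    rw [dist_eq, SimpleGraph.dist_eq_one_iff_adj.2 hadj, Nat.cast_one]

end Vertex

/-- A lower bound on the cost of serving a request to `x` from the configuration `D`, namely the
distance of `x` to the nearest server, truncated at `2`. -/
noncomputable def serveCost {k q : ℕ} (D : Config (Vertex k q) k) (x : Vertex k q) : ℝ :=
  open Classical in if Covers D x then 0 else if ∃ i, (D i).Close x then 1 else 2

theorem serveCost_le_two {k q : ℕ} (D : Config (Vertex k q) k) (x : Vertex k q) :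
    serveCost D x ≤ 2 := by
  unfold serveCost
  split_ifs <;> norm_num

theorem serveCost_le_stepCost {k q : ℕ} [NeZero k] {D E : Config (Vertex k q) k} {x : Vertex k q}
    (hx : Covers E x) : serveCost D x ≤ stepCost D E := by
  obtain ⟨i, rfl⟩ := hx
  refine le_trans ?_ (dist_le_stepCost D E i)
  unfold serveCost
  split_ifs with h1 h2
  · exact dist_nonneg
  · exact Vertex.one_le_dist fun h => h1 ⟨i, h⟩
  · exact Vertex.two_le_dist fun h => h2 ⟨i, h⟩

/-! ### The random request sequence -/

/-- The state of the random request sequence. In a phase, `k` new points are requested one after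
the other, starting from a set of `k` old points. The old points lie in the `k` columns of one
side, the new ones in the `k` columns of the other side.

The first new point is adjacent to all old points. Every other new point is only known to be
adjacent to one old point, its origin, which is drawn at random among the old points that are not
yet the origin of another new point. -/
structure PhaseState (k q : ℕ) where
  /-- The side of the old points. -/
  side : Bool
  /-- The labels of the old points. -/
  old : Fin k → Column k → Fin (q + 1)
  /-- The labels of the new points; only those before `pos` matter. -/
  new : Fin k → Column k → Fin (q + 1)
  /-- The indices of the origins of the new points; only those strictly between `0` and `pos`
  matter. -/
  origin : Fin k → Fin k
  /-- The index of the new point to be requested next. -/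
  pos : Fin k

namespace PhaseState

variable {k q : ℕ} [NeZero k] (st : PhaseState k q)

/-- The old point with index `i`. -/
def oldPoint (i : Fin k) : Vertex k q := ⟨(st.side, i), st.old i⟩

/-- The new point with index `i`. -/
def newPoint (i : Fin k) : Vertex k q := ⟨(!st.side, i), st.new i⟩

/-- The (indices of the) old points that are not yet the origin of a new point. -/
def free : Finset (Fin k) := ((Finset.Ioo 0 st.pos).image st.origin)ᶜ

/-- The outcomes of the next random choice, which is a uniform one: a free old point and a
labelling. -/
def choices : Finset (Fin k × (Column k → Fin (q + 1))) := st.free ×ˢ Finset.univ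

/-- The labels of the next new point. For the first one, the label for the column of each old point
is such that the points are close. For every other one, all labels are the random ones, except
the one that makes the new point close to its random origin. -/
def nextLabel (y : Fin k × (Column k → Fin (q + 1))) : Column k → Fin (q + 1) :=
  if st.pos = 0 then fun c => st.old c.2 (!st.side, st.pos)
  else Function.update y.2 (st.side, y.1) (st.old y.1 (!st.side, st.pos))

/-- The next new point, given the outcome of the random choice. -/
def nextPoint (y : Fin k × (Column k → Fin (q + 1))) : Vertex k q :=
  ⟨(!st.side, st.pos), st.nextLabel y⟩

/-- The state after the next random choice. When all new points of the phase have been chosen, they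
become the old points of the next phase. -/
def next (y : Fin k × (Column k → Fin (q + 1))) : PhaseState k q :=
  if h : st.pos.val + 1 < k then
    { side := st.side
      old := st.old
      new := Function.update st.new st.pos (st.nextLabel y)
      origin := Function.update st.origin st.pos y.1
      pos := ⟨st.pos.val + 1, h⟩ }
  else
    { side := !st.side
      old := Function.update st.new st.pos (st.nextLabel y)
      new := Function.update st.new st.pos (st.nextLabel y)
      origin := st.origin
      pos := 0 }

/-- The new points up to and including the next one. -/
def round (y : Fin k × (Column k → Fin (q + 1))) : List (Vertex k q) :=
  ((List.finRange k).filter (· ≤ st.pos)).map fun i =>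
    ⟨(!st.side, i), Function.update st.new st.pos (st.nextLabel y) i⟩

/-- The requests that the next random choice leads to. The number `4` of rounds is large enough for
an algorithm not to profit from leaving out some of the points. -/
def batch (y : Fin k × (Column k → Fin (q + 1))) : List (Vertex k q) :=
  (List.replicate 4 (st.round y)).flatten

/-- A configuration is up to date if it covers all new points requested so far, or all old points
if none has been requested. -/
def UpToDate (D : Config (Vertex k q) k) : Prop :=
  if st.pos = 0 then ∀ i, Covers D (st.oldPoint i) else ∀ i < st.pos, Covers D (st.newPoint i)

variable {st}

theorem mem_round {y : Fin k × (Column k → Fin (q + 1))} {v : Vertex k q} :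
    v ∈ st.round y ↔ ∃ i ≤ st.pos,
      (⟨(!st.side, i), Function.update st.new st.pos (st.nextLabel y) i⟩ : Vertex k q) = v := by
  simp [round]

theorem nextPoint_mem_round (y : Fin k × (Column k → Fin (q + 1))) :
    st.nextPoint y ∈ st.round y :=
  mem_round.2 ⟨st.pos, le_rfl, by simp [nextPoint]⟩

theorem upToDate_next {y : Fin k × (Column k → Fin (q + 1))} {D : Config (Vertex k q) k}
    (h : ∀ v ∈ st.round y, Covers D v) : (st.next y).UpToDate D := by
  have h' : ∀ i ≤ st.pos, Covers D
      ⟨(!st.side, i), Function.update st.new st.pos (st.nextLabel y) i⟩ :=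
    fun i hi => h _ (mem_round.2 ⟨i, hi, rfl⟩)
  unfold next UpToDate
  split_ifs with h1 h2 h2
  · exact absurd (congrArg Fin.val h2) (by simp)
  · intro i hi
    exact h' i (Fin.le_def.2 (Nat.lt_succ_iff.1 (Fin.lt_def.1 hi)))
  · intro i
    exact h' i (Fin.le_def.2 (by omega))
  · simp at h2

theorem le_card_free (h : st.pos ≠ 0) : k - st.pos + 1 ≤ st.free.card := by
  have h1 : ((Finset.Ioo 0 st.pos).image st.origin).card ≤ st.pos - 1 :=
    Finset.card_image_le.trans (by simp)
  have h2 : st.pos.val ≠ 0 := fun h' => h (Fin.ext (by simpa using h'))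
  rw [free, Finset.card_compl, Fintype.card_fin]
  omega

theorem free_nonempty : st.free.Nonempty := by
  by_cases h : st.pos = 0
  · rw [free, h]
    simp
  · exact Finset.card_pos.1 (Nat.lt_of_lt_of_le (Nat.succ_pos _) (le_card_free h))

theorem choices_nonempty : st.choices.Nonempty :=
  free_nonempty.product Finset.univ_nonempty

/-! ### The expected cost of a new point -/

/-- A configuration covering the old points has no server elsewhere, so that it has to pay for the
first new point. -/
theorem one_le_serveCost {D : Config (Vertex k q) k} (hpos : st.pos = 0) (hD : st.UpToDate D)
    (y : Fin k × (Column k → Fin (q + 1))) : 1 ≤ serveCost D (st.nextPoint y) := by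
  rw [UpToDate, if_pos hpos] at hD
  choose a ha using hD
  have hinj : Function.Injective a := fun i j hij => by
    have h := (ha i).symm.trans ((congrArg D hij).trans (ha j))
    exact congrArg (fun v => v.col.2) h
  have hcov : ¬ Covers D (st.nextPoint y) := by
    rintro ⟨i, hi⟩
    obtain ⟨j, rfl⟩ := Finite.surjective_of_injective hinj i
    rw [ha j] at hi
    simpa [oldPoint, nextPoint] using congrArg (fun v => v.col.1) hi
  unfold serveCost
  rw [if_neg hcov]
  split_ifs <;> norm_num

open Classical in
/-- The cost of a later new point. It is `2` if no server is in the column of the origin, and at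
least `1` otherwise, except for coincidences of the random labels. -/
theorem le_serveCost {D : Config (Vertex k q) k} (hpos : st.pos ≠ 0)
    (y : Fin k × (Column k → Fin (q + 1))) :
    1 + (if ∃ i, (D i).col = (st.side, y.1) then (0 : ℝ) else 1) -
      2 * ∑ i, (if y.2 (D i).col = (D i).label (!st.side, st.pos) then (1 : ℝ) else 0) ≤
      serveCost D (st.nextPoint y) := by
  by_cases hb : ∃ i, y.2 (D i).col = (D i).label (!st.side, st.pos)
  · obtain ⟨i, hi⟩ := hb
    have h1 : (1 : ℝ) ≤
        ∑ i, (if y.2 (D i).col = (D i).label (!st.side, st.pos) then (1 : ℝ) else 0) := by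
      have := Finset.single_le_sum (s := Finset.univ)
        (f := fun i => if y.2 (D i).col = (D i).label (!st.side, st.pos) then (1 : ℝ) else 0)
        (fun i _ => by split_ifs <;> norm_num) (Finset.mem_univ i)
      simpa [hi] using this
    have h2 : 0 ≤ serveCost D (st.nextPoint y) := by
      unfold serveCost; split_ifs <;> norm_num
    have h3 : (if ∃ i, (D i).col = (st.side, y.1) then (0 : ℝ) else 1) ≤ 1 := by
      split_ifs <;> norm_num
    linarith
  · push Not at hb
    have hclose : ∀ i, (D i).col ≠ (st.side, y.1) → ¬ (D i).Close (st.nextPoint y) := by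
      intro i hi hc
      apply hb i
      have : (D i).label (!st.side, st.pos) = st.nextLabel y (D i).col := hc
      rw [this, nextLabel, if_neg hpos, Function.update_of_ne hi]
    have hcov : ¬ Covers D (st.nextPoint y) := by
      rintro ⟨i, hi⟩
      refine hclose i ?_ (by rw [hi]; rfl)
      rw [hi]
      simp [nextPoint]
    rw [Finset.sum_eq_zero fun i _ => if_neg (hb i)]
    unfold serveCost
    rw [if_neg hcov]
    split_ifs with h1 h2 h2
    · norm_num
    · norm_num
    · obtain ⟨i, hi⟩ := h2
      exact absurd hi (hclose i fun h => h1 ⟨i, h⟩)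
    · norm_num

open Classical in
/-- As the servers of an up-to-date configuration are at the new points, there is a column of a free
old point without a server, and the origin lies in such a column with at least the given
probability. -/
theorem le_expect_unoccupied {D : Config (Vertex k q) k} (hpos : st.pos ≠ 0)
    (hD : st.UpToDate D) :
    1 / ((k : ℝ) - (st.pos : ℕ) + 1) ≤
      Finset.expect st.free fun p => if ∃ i, (D i).col = (st.side, p) then (0 : ℝ) else 1 := by
  rw [UpToDate, if_neg hpos] at hD
  have hlt : (st.pos : ℕ) < k := st.pos.2
  set occ : Finset (Fin k) := Finset.univ.filter fun p => ∃ i, (D i).col = (st.side, p) with hocc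
  have hnew : (st.pos : ℕ) ≤ (Finset.univ.filter fun i => ¬ (D i).col.1 = st.side).card := by
    rw [← Fin.card_Iio st.pos]
    refine (Finset.card_le_card ?_).trans
      (Finset.card_image_le (f := fun i => (D i).col.2))
    intro i hi
    obtain ⟨a, ha⟩ := hD i (Finset.mem_Iio.1 hi)
    refine Finset.mem_image.2 ⟨a, ?_, ?_⟩
    · simp [ha, newPoint]
    · simp [ha, newPoint]
  have hold : occ.card ≤ (Finset.univ.filter fun i => (D i).col.1 = st.side).card := by
    refine (Finset.card_le_card ?_).trans
      (Finset.card_image_le (f := fun i => (D i).col.2))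
    intro p hp
    obtain ⟨i, hi⟩ := (Finset.mem_filter.1 hp).2
    exact Finset.mem_image.2 ⟨i, by simp [hi], by simp [hi]⟩
  have hsum := Finset.card_filter_add_card_filter_not (s := (Finset.univ : Finset (Fin k)))
    (fun i => (D i).col.1 = st.side)
  rw [Finset.card_univ, Fintype.card_fin] at hsum
  have hocc_card : occ.card + st.pos ≤ k := by omega
  have hfree := le_card_free hpos
  have hunocc : st.free.card ≤ (st.free \ occ).card + occ.card := by
    have := Finset.le_card_sdiff occ st.free
    omega
  have hval : ∑ p ∈ st.free, (if ∃ i, (D i).col = (st.side, p) then (0 : ℝ) else 1) =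
      ((st.free \ occ).card : ℝ) := by
    rw [Finset.card_eq_sum_ones, Nat.cast_sum, ← Finset.filter_notMem_eq_sdiff,
      Finset.sum_filter]
    refine Finset.sum_congr rfl fun p _ => ?_
    have hmem : p ∈ occ ↔ ∃ i, (D i).col = (st.side, p) := by simp [hocc]
    by_cases h : ∃ i, (D i).col = (st.side, p)
    · rw [if_pos h, if_neg (not_not.2 (hmem.2 h))]
    · rw [if_neg h, if_pos fun h' => h (hmem.1 h'), Nat.cast_one]
  rw [Finset.expect_eq_sum_div_card, hval]
  have h1 : ((st.pos : ℕ) : ℝ) + 1 ≤ k := by exact_mod_cast hlt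
  have h2 : (k : ℝ) - (st.pos : ℕ) + 1 ≤ st.free.card := by
    have : k + 1 ≤ st.free.card + st.pos := by omega
    have : (k : ℝ) + 1 ≤ st.free.card + (st.pos : ℕ) := by exact_mod_cast this
    linarith
  have h3 : (st.free.card : ℝ) ≤ (st.free \ occ).card + occ.card := by exact_mod_cast hunocc
  have h4 : (occ.card : ℝ) + (st.pos : ℕ) ≤ k := by exact_mod_cast hocc_card
  rw [div_le_div_iff₀ (by linarith) (by linarith)]
  nlinarith

theorem expect_label_eq (c : Column k) (a : Fin (q + 1)) :
    (Finset.expect Finset.univ fun f : Column k → Fin (q + 1) =>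
      if f c = a then (1 : ℝ) else 0) = 1 / ((q : ℝ) + 1) := by
  have hcard := Fintype.card_filter_piFinset_const_eq_of_mem
    (Finset.univ : Finset (Fin (q + 1))) c (Finset.mem_univ a)
  rw [Fintype.piFinset_univ, Finset.card_univ, Fintype.card_fin] at hcard
  rw [Finset.expect_eq_sum_div_card, Finset.sum_boole, hcard, Finset.card_univ,
    Fintype.card_fun, Fintype.card_fin]
  have hk : 0 < Fintype.card (Column k) := Fintype.card_pos
  obtain ⟨m, hm⟩ := Nat.exists_eq_succ_of_ne_zero hk.ne'
  rw [hm, Nat.succ_sub_one]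
  push_cast
  rw [pow_succ]
  field_simp

end PhaseState

/-- A lower bound on the expected cost of serving the new point with index `j`. -/
noncomputable def gain (k q j : ℕ) : ℝ :=
  if j = 0 then 1 else 1 + 1 / ((k : ℝ) - j + 1) - 2 * (k / ((q : ℝ) + 1))

theorem gain_le_two {k q j : ℕ} (hj : j < k) : gain k q j ≤ 2 := by
  unfold gain
  split_ifs with h
  · norm_num
  · have h1 : (j : ℝ) + 1 ≤ k := by exact_mod_cast hj
    have h2 : 1 / ((k : ℝ) - j + 1) ≤ 1 := by
      rw [div_le_one (by linarith)]; linarith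
    have h3 : 0 ≤ (k : ℝ) / ((q : ℝ) + 1) := by positivity
    linarith

theorem PhaseState.gain_le_expect {k q : ℕ} [NeZero k] {st : PhaseState k q}
    {D : Config (Vertex k q) k} (hD : st.UpToDate D) :
    gain k q st.pos ≤ Finset.expect st.choices fun y => serveCost D (st.nextPoint y) := by
  classical
  by_cases hpos : st.pos = 0
  · rw [gain, if_pos (by simp [hpos])]
    exact Finset.le_expect choices_nonempty fun y _ => one_le_serveCost hpos hD y
  · rw [gain, if_neg fun h => hpos (Fin.ext (by simpa using h))]
    refine le_trans ?_ (Finset.expect_le_expect fun y _ => le_serveCost hpos y)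
    have hinner : ∀ p, (Finset.expect Finset.univ fun f : Column k → Fin (q + 1) =>
        1 + (if ∃ i, (D i).col = (st.side, p) then (0 : ℝ) else 1) -
          2 * ∑ i, (if f (D i).col = (D i).label (!st.side, st.pos) then (1 : ℝ) else 0)) =
        (if ∃ i, (D i).col = (st.side, p) then (0 : ℝ) else 1) +
          (1 - 2 * (k / ((q : ℝ) + 1))) := by
      intro p
      rw [Finset.expect_sub_distrib, Finset.expect_const Finset.univ_nonempty,
        ← Finset.mul_expect, Finset.expect_sum_comm, Finset.sum_congr rfl fun i _ =>
          expect_label_eq _ _, Finset.sum_const, Finset.card_univ, Fintype.card_fin, nsmul_eq_mul]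
      ring
    rw [choices, Finset.expect_product, Finset.expect_congr rfl fun p _ => hinner p,
      Finset.expect_add_distrib, Finset.expect_const free_nonempty]
    have := le_expect_unoccupied hpos hD
    linarith

theorem sum_gain (k q : ℕ) :
    ∑ j ∈ Finset.range (k + 1), gain (k + 1) q j =
      (k + 1 : ℕ) + (harmonic (k + 1) : ℝ) - 1 - k * (2 * ((k + 1 : ℕ) / ((q : ℝ) + 1))) := by
  have hharm : (harmonic (k + 1) : ℝ) = 1 + ∑ j ∈ Finset.range k, 1 / ((j : ℝ) + 2) := by
    rw [harmonic, Finset.sum_range_succ']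
    push_cast
    rw [add_comm]
    congr 1
    · norm_num
    · exact Finset.sum_congr rfl fun j _ => by rw [one_div]; congr 1; ring
  rw [Finset.sum_range_succ', hharm, ← Finset.sum_range_reflect]
  have hterm : ∀ j ∈ Finset.range k, gain (k + 1) q (k - 1 - j + 1) =
      (1 - 2 * ((k + 1 : ℕ) / ((q : ℝ) + 1))) + 1 / ((j : ℝ) + 2) := by
    intro j hj
    have hj := Finset.mem_range.1 hj
    have h1 : ((k - 1 - j + 1 : ℕ) : ℝ) = k - j := by
      rw [show k - 1 - j + 1 = k - j by omega, Nat.cast_sub hj.le]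
    rw [gain, if_neg (Nat.succ_ne_zero _), h1,
      show ((k + 1 : ℕ) : ℝ) - (k - j) + 1 = j + 2 by push_cast; ring]
    ring
  rw [Finset.sum_congr rfl hterm, Finset.sum_add_distrib, Finset.sum_const, Finset.card_range,
    nsmul_eq_mul, gain, if_pos rfl]
  push_cast
  ring

/-! ### Averages over the random request sequence -/

namespace PhaseState

variable {k q : ℕ} [NeZero k]

/-- The expected value of `φ` at the request sequence generated by `n` random choices, starting in
the state `st`. -/
noncomputable def average : ℕ → PhaseState k q → (List (Vertex k q) → ℝ) → ℝ
  | 0, _, φ => φ []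
  | n + 1, st, φ =>
    Finset.expect st.choices fun y => average n (st.next y) fun l => φ (st.batch y ++ l)

/-- The request sequences that `n` random choices, starting in the state `st`, can generate. -/
def IsOutcome : ℕ → PhaseState k q → List (Vertex k q) → Prop
  | 0, _, l => l = []
  | n + 1, st, l => ∃ y ∈ st.choices, ∃ l', IsOutcome n (st.next y) l' ∧ l = st.batch y ++ l'

theorem average_const_add (n : ℕ) (st : PhaseState k q) (a : ℝ) (φ : List (Vertex k q) → ℝ) :
    average n st (fun l => a + φ l) = a + average n st φ := by
  induction n generalizing st φ with
  | zero => rfl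
  | succ n ih =>
    simp only [average, ih]
    rw [Finset.expect_add_distrib, Finset.expect_const choices_nonempty]

theorem exists_isOutcome_of_le_average {n : ℕ} {st : PhaseState k q} {a : ℝ}
    {φ : List (Vertex k q) → ℝ} (h : a ≤ average n st φ) : ∃ l, IsOutcome n st l ∧ a ≤ φ l := by
  induction n generalizing st φ with
  | zero => exact ⟨[], rfl, h⟩
  | succ n ih =>
    obtain ⟨y, hy, h⟩ := Finset.exists_le_of_le_expect choices_nonempty h
    obtain ⟨l, hl, h⟩ := ih h
    exact ⟨_, ⟨y, hy, l, hl, rfl⟩, h⟩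

theorem integrable_average {Ω : Type v} [MeasurableSpace Ω] {P : Measure Ω} (n : ℕ)
    (st : PhaseState k q) {φ : Ω → List (Vertex k q) → ℝ}
    (hφ : ∀ l, Integrable (fun ω => φ ω l) P) : Integrable (fun ω => average n st (φ ω)) P := by
  induction n generalizing st φ with
  | zero => exact hφ []
  | succ n ih =>
    simp only [average, Finset.expect_eq_sum_div_card]
    exact (integrable_finsetSum _ fun y _ => ih _ fun l => hφ _).div_const _

theorem integral_average {Ω : Type v} [MeasurableSpace Ω] {P : Measure Ω} (n : ℕ)
    (st : PhaseState k q) {φ : Ω → List (Vertex k q) → ℝ}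
    (hφ : ∀ l, Integrable (fun ω => φ ω l) P) :
    ∫ ω, average n st (φ ω) ∂P = average n st fun l => ∫ ω, φ ω l ∂P := by
  induction n generalizing st φ with
  | zero => rfl
  | succ n ih =>
    simp only [average, Finset.expect_eq_sum_div_card]
    rw [integral_div, integral_finsetSum _ fun y _ => integrable_average n _ fun l => hφ _]
    simp only [ih _ fun l => hφ _]

/-! ### The cost of an online algorithm -/

/-- The lower bound on the expected cost of the remaining requests if `m` phases, including the
current one, are still to be completed. -/
noncomputable def target (m : ℕ) (st : PhaseState k q) : ℝ :=
  m * ∑ j ∈ Finset.range k, gain k q j - ∑ j ∈ Finset.range st.pos, gain k q j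

theorem exists_target_eq {n m : ℕ} {st : PhaseState k q} (h : n + 1 + st.pos = k * m) :
    ∃ m', (∀ y, n + (st.next y).pos = k * m') ∧
      ∀ y, target m st = gain k q st.pos + target m' (st.next y) := by
  by_cases hlt : st.pos.val + 1 < k
  · refine ⟨m, fun y => ?_, fun y => ?_⟩
    · rw [next, dif_pos hlt]; dsimp only; omega
    · rw [target, target, next, dif_pos hlt]
      dsimp only
      rw [Finset.sum_range_succ _ st.pos.val]
      ring
  · have hpos : st.pos.val + 1 = k := by have := st.pos.2; omega
    cases m with
    | zero => omega
    | succ m =>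
      rw [mul_add, mul_one] at h
      refine ⟨m, fun y => ?_, fun y => ?_⟩
      · rw [next, dif_neg hlt]; simp only [Fin.val_zero]; omega
      · have hsum : ∑ j ∈ Finset.range k, gain k q j =
            ∑ j ∈ Finset.range st.pos, gain k q j + gain k q st.pos := by
          rw [← Finset.sum_range_succ, hpos]
        rw [target, target, next, dif_neg hlt]
        simp only [Fin.val_zero, Finset.range_zero, Finset.sum_empty]
        push_cast
        linarith

/-- Every deterministic algorithm pays at least `target` on average. To be able to compare the
algorithm with one that covers all new points after each batch, the bound is proved for the cost
of the remaining requests plus the cost `stepCost D E` of reaching the current configuration `E`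
from an arbitrary up-to-date configuration `D`. -/
theorem target_le_average (A : OnlineAlgorithm (Vertex k q) k) (C₀ : Config (Vertex k q) k)
    (n m : ℕ) (st : PhaseState k q) (h : n + st.pos = k * m) (past : List (Vertex k q))
    (E : Config (Vertex k q) k) :
    (target m st - 2 ≤ average n st fun l => cost E (A.runFrom C₀ past l)) ∧
      ∀ D, st.UpToDate D →
        target m st ≤ stepCost D E + average n st fun l => cost E (A.runFrom C₀ past l) := by
  induction n generalizing st m past E with
  | zero =>
    have hlt := st.pos.2
    have hm : m = 0 := by
      by_contra hm
      have := Nat.le_mul_of_pos_right k (Nat.pos_of_ne_zero hm)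
      omega
    have hpos : st.pos.val = 0 := by simpa [hm] using h
    have ht : target m st = 0 := by simp [target, hm, hpos]
    have ha : (average 0 st fun l => cost E (A.runFrom C₀ past l)) = 0 := by
      simp [average, OnlineAlgorithm.runFrom, cost]
    rw [ht, ha]
    exact ⟨by norm_num, fun D _ => by simpa using stepCost_nonneg D E⟩
  | succ n ih =>
    obtain ⟨m', hm', ht⟩ := exists_target_eq h
    rw [average]
    set ψ : Fin k × (Column k → Fin (q + 1)) → ℝ := fun y =>
      average n (st.next y) fun l => cost E (A.runFrom C₀ past (st.batch y ++ l)) with hψ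
    have key : ∀ y, target m' (st.next y) ≤ ψ y ∧
        ∀ D, target m' (st.next y) + serveCost D (st.nextPoint y) ≤ stepCost D E + ψ y := by
      intro y
      set S := A.runFrom C₀ past (st.batch y) with hS
      set E' := S.getLastD E with hE'
      have hψy : ψ y = cost E S +
          average n (st.next y) fun l => cost E' (A.runFrom C₀ (past ++ st.batch y) l) := by
        simp only [hψ, OnlineAlgorithm.runFrom_append, cost_append, average_const_add]
        rfl
      obtain ⟨ih1, ih2⟩ := ih m' (st.next y) (hm' y) (past ++ st.batch y) E'
      rw [hψy]
      rcases exists_covering_or_le_cost (fun _ _ => Vertex.one_le_dist) (st.round y) 4 (C := E)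
        (A.forall₂_covers_runFrom C₀ past (st.batch y)) with ⟨D', hD', hcost⟩ | hcost
      · have h1 := ih2 D' (upToDate_next hD')
        have h2 := stepCost_nonneg E D'
        refine ⟨by linarith, fun D => ?_⟩
        have h3 := serveCost_le_stepCost (D := D) (hD' _ (st.nextPoint_mem_round y))
        have h4 := stepCost_triangle D E D'
        linarith
      · push_cast at hcost
        refine ⟨by linarith, fun D => ?_⟩
        have h3 := serveCost_le_two D (st.nextPoint y)
        have h4 := stepCost_nonneg D E
        linarith
    constructor
    · refine Finset.le_expect choices_nonempty fun y _ => ?_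
      have h1 := (key y).1
      have h2 := ht y
      have h3 := gain_le_two (q := q) st.pos.2
      linarith
    · intro D hD
      have h1 : (Finset.expect st.choices fun y =>
          target m st - gain k q st.pos + serveCost D (st.nextPoint y)) ≤
          Finset.expect st.choices fun y => stepCost D E + ψ y :=
        Finset.expect_le_expect fun y _ => by
          have h1 := (key y).2 D
          have h2 := ht y
          linarith
      rw [Finset.expect_add_distrib, Finset.expect_add_distrib,
        Finset.expect_const choices_nonempty, Finset.expect_const choices_nonempty] at h1
      have h2 := gain_le_expect hD
      linarith

/-! ### The optimal cost -/

/-- The labels `new` of the points on the opposite side, as far as they belong to indices in `s`,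
are compatible with those of the points `old` in the columns of `side`: the point with index `0` is
close to all old points, and the others are close to distinct old points given by `origin`. -/
structure IsLinked (side : Bool) (old new : Fin k → Column k → Fin (q + 1))
    (origin : Fin k → Fin k) (s : Set (Fin k)) : Prop where
  zero : 0 ∈ s → ∀ a, old a (!side, 0) = new 0 (side, a)
  injOn : Set.InjOn origin (s \ {0})
  origin : ∀ i ∈ s, i ≠ 0 → old (origin i) (!side, i) = new i (side, origin i)

theorem IsLinked.update {st : PhaseState k q}
    (h : IsLinked st.side st.old st.new st.origin (Set.Iio st.pos))
    {y : Fin k × (Column k → Fin (q + 1))} (hy : y ∈ st.choices) :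
    IsLinked st.side st.old (Function.update st.new st.pos (st.nextLabel y))
      (Function.update st.origin st.pos y.1) (Set.Iic st.pos) := by
  have hfree : ∀ i < st.pos, i ≠ 0 → st.origin i ≠ y.1 := by
    intro i hi h0 heq
    have := (Finset.mem_product.1 hy).1
    rw [free, Finset.mem_compl] at this
    exact this (Finset.mem_image.2 ⟨i, Finset.mem_Ioo.2 ⟨Fin.pos_iff_ne_zero.2 h0, hi⟩, heq⟩)
  refine ⟨fun _ a => ?_, ?_, ?_⟩
  · by_cases hpos : st.pos = 0
    · rw [← hpos, Function.update_self, nextLabel, if_pos hpos]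
    · rw [Function.update_of_ne (Ne.symm hpos)]
      exact h.zero (Fin.pos_iff_ne_zero.2 hpos) a
  · rintro i ⟨hi, hi0⟩ j ⟨hj, hj0⟩ hij
    rcases (Set.mem_Iic.1 hi).lt_or_eq with hi' | rfl <;>
      rcases (Set.mem_Iic.1 hj).lt_or_eq with hj' | rfl
    · rw [Function.update_of_ne hi'.ne, Function.update_of_ne hj'.ne] at hij
      exact h.injOn ⟨hi', hi0⟩ ⟨hj', hj0⟩ hij
    · rw [Function.update_of_ne hi'.ne, Function.update_self] at hij
      exact absurd hij (hfree i hi' hi0)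
    · rw [Function.update_of_ne hj'.ne, Function.update_self] at hij
      exact absurd hij.symm (hfree j hj' hj0)
    · rfl
  · intro i hi hi0
    rcases (Set.mem_Iic.1 hi).lt_or_eq with hi' | rfl
    · rw [Function.update_of_ne hi'.ne, Function.update_of_ne hi'.ne]
      exact h.origin i hi' hi0
    · rw [Function.update_self, Function.update_self, nextLabel, if_neg hi0,
        Function.update_self]

/-- Once all new points are known, the old points can be matched with them. -/
theorem IsLinked.exists_perm {side : Bool} {old new : Fin k → Column k → Fin (q + 1)}
    {origin : Fin k → Fin k} (h : IsLinked side old new origin Set.univ) :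
    ∃ e : Equiv.Perm (Fin k), ∀ i, old (e i) (!side, i) = new i (side, e i) := by
  obtain ⟨g, hg⟩ := Finset.exists_equiv_extend_of_card_eq (α := Fin k) (t := Finset.univ)
    (s := Finset.univ.erase 0) (f := origin) (by simp) (Finset.subset_univ _)
    (h.injOn.mono (by simp))
  let e : Equiv.Perm (Fin k) := g.trans (Equiv.subtypeUnivEquiv Finset.mem_univ)
  have he : ∀ i, e i = (g i : Fin k) := fun i => rfl
  refine ⟨e, fun i => ?_⟩
  by_cases hi : i = 0
  · subst hi
    exact h.zero trivial _
  · rw [he, hg i (Finset.mem_erase.2 ⟨hi, Finset.mem_univ _⟩)]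
    exact h.origin i trivial hi

/-- The optimal cost is at most `1` per phase: the servers move to the new points of the phase, all
of them at once, when the first one is requested. Hence, unless a phase is about to begin, the
servers have already moved from the old points to a suitable configuration `O`. -/
theorem exists_solution (n m : ℕ) (st : PhaseState k q) (h : n + st.pos = k * m)
    (hst : IsLinked st.side st.old st.new st.origin (Set.Iio st.pos)) (l : List (Vertex k q))
    (hl : IsOutcome n st l) (σ : Equiv.Perm (Fin k)) :
    (st.pos = 0 → ∃ S, List.Forall₂ Covers S l ∧ cost (fun i => st.oldPoint (σ i)) S ≤ m) ∧
      (st.pos ≠ 0 → ∃ O : Config (Vertex k q) k, (∀ i, (st.oldPoint (σ i)).Close (O i)) ∧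
        (∀ i < st.pos, Covers O (st.newPoint i)) ∧
        ∃ S, List.Forall₂ Covers S l ∧ cost O S + 1 ≤ m) := by
  induction n generalizing st m l σ with
  | zero =>
    have hlt := st.pos.2
    have hm : m = 0 := by
      by_contra hm
      have := Nat.le_mul_of_pos_right k (Nat.pos_of_ne_zero hm)
      omega
    have hpos : st.pos.val = 0 := by simpa [hm] using h
    obtain rfl : l = [] := hl
    exact ⟨fun _ => ⟨[], List.Forall₂.nil, by simp [cost]⟩,
      fun h => absurd (Fin.ext (by simpa using hpos)) h⟩
  | succ n ih =>
    obtain ⟨y, hy, l, hl, rfl⟩ := hl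
    have hlink := hst.update hy
    -- The configuration `O` depends on the rest of the phase.
    obtain ⟨O, hclose, hround, S, hS, hcost⟩ : ∃ O : Config (Vertex k q) k,
        (∀ i, (st.oldPoint (σ i)).Close (O i)) ∧ (∀ v ∈ st.round y, Covers O v) ∧
        ∃ S, List.Forall₂ Covers S l ∧ cost O S + 1 ≤ m := by
      by_cases hlt : st.pos.val + 1 < k
      · have hnext : st.next y = _ := dif_pos hlt
        rw [hnext] at hl
        have hIio : Set.Iio (⟨st.pos.val + 1, hlt⟩ : Fin k) = Set.Iic st.pos := by
          ext i
          exact Fin.lt_def.trans (Nat.lt_succ_iff.trans Fin.le_def.symm)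
        obtain ⟨O, h1, h2, h3⟩ := (ih m _ (by dsimp only; omega) (by rw [hIio]; exact hlink)
          l hl σ).2 (fun h => by simpa using congrArg Fin.val h)
        refine ⟨O, h1, fun v hv => ?_, h3⟩
        obtain ⟨i, hi, rfl⟩ := mem_round.1 hv
        exact h2 i (Fin.lt_def.2 (Nat.lt_succ_iff.2 (Fin.le_def.1 hi)))
      · have hpos : st.pos.val + 1 = k := by have := st.pos.2; omega
        have hnext : st.next y = _ := dif_neg hlt
        rw [hnext] at hl
        cases m with
        | zero => omega
        | succ m =>
          rw [mul_add, mul_one] at h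
          have hIic : Set.Iic st.pos = Set.univ := by
            ext i
            have := i.2
            simp only [Set.mem_Iic, Fin.le_def, Set.mem_univ, iff_true]
            omega
          rw [hIic] at hlink
          obtain ⟨e, he⟩ := hlink.exists_perm
          obtain ⟨S, hS, hcost⟩ := (ih m _ (by simp only [Fin.val_zero]; omega)
            ⟨fun h => by simp at h, fun i hi => by simp at hi, fun i hi => by simp at hi⟩
            l hl (σ.trans e.symm)).1 rfl
          refine ⟨_, fun i => ?_, fun v hv => ?_, S, hS, by push_cast; linarith⟩
          · have := he (e.symm (σ i))
            rw [Equiv.apply_symm_apply] at this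
            exact this
          · obtain ⟨i, -, rfl⟩ := mem_round.1 hv
            refine ⟨σ.symm (e i), ?_⟩
            simp [oldPoint]
    have hbatch : List.Forall₂ Covers (List.replicate (st.batch y).length O) (st.batch y) := by
      have hcov : ∀ v ∈ st.batch y, Covers O v := by
        intro v hv
        simp only [batch, List.mem_flatten, List.mem_replicate] at hv
        obtain ⟨_, ⟨-, rfl⟩, hv⟩ := hv
        exact hround v hv
      generalize st.batch y = L at hcov
      clear * - hcov
      induction L with
      | nil => exact List.Forall₂.nil
      | cons v l ih =>
        exact List.Forall₂.cons (hcov v List.mem_cons_self)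
          (ih fun w hw => hcov w (List.mem_cons_of_mem _ hw))
    have hsol := List.rel_append hbatch hS
    refine ⟨fun _ => ⟨_, hsol, ?_⟩, fun hpos => ⟨O, hclose, fun i hi => ?_, _, hsol, ?_⟩⟩
    · have h1 := cost_replicate_append_le (fun i => st.oldPoint (σ i)) O (st.batch y).length S
      have h2 : stepCost (fun i => st.oldPoint (σ i)) O ≤ 1 :=
        stepCost_le zero_le_one fun i => (hclose i).dist_le_one
      linarith
    · refine hround _ (mem_round.2 ⟨i, hi.le, ?_⟩)
      rw [Function.update_of_ne hi.ne]
      rfl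
    · have h1 := cost_replicate_append_le O O (st.batch y).length S
      rw [stepCost_self] at h1
      linarith

/-- The state at the beginning of the first phase. -/
def start (k q : ℕ) [NeZero k] : PhaseState k q := ⟨false, 0, 0, id, 0⟩

end PhaseState

/-! ### The competitive ratio -/

/-- On the random request sequence with `m` phases, the expected cost of a randomized algorithm is at
least `m` times the total gain of a phase, whereas the optimal cost is always at most `m`. -/
theorem RandomizedOnlineAlgorithm.exists_instance {k q : ℕ} [NeZero k]
    (R : RandomizedOnlineAlgorithm.{0, v} (Vertex k q) k) (m : ℕ)
    (hR : letI := R.mΩ; ∀ I : ServerInstance (Vertex k q) k,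
      Integrable (fun ω => cost I.init ((R.alg ω).run I)) R.P) :
    letI := R.mΩ
    ∃ I : ServerInstance (Vertex k q) k, optCost I ≤ m ∧
      m * ∑ j ∈ Finset.range k, gain k q j ≤ ∫ ω, cost I.init ((R.alg ω).run I) ∂(R.P) := by
  let := R.mΩ
  have := R.isProb
  let st := PhaseState.start k q
  let C₀ : Config (Vertex k q) k := st.oldPoint
  have hC₀ : st.UpToDate C₀ := by
    rw [PhaseState.UpToDate, if_pos (show st.pos = 0 from rfl)]
    exact fun i => ⟨i, rfl⟩
  have hint : ∀ l, Integrable (fun ω => cost C₀ ((R.alg ω).runFrom C₀ [] l)) R.P :=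
    fun l => hR ⟨C₀, l⟩
  have hn : k * m + st.pos = k * m := by simp [st, PhaseState.start]
  have htarget : PhaseState.target m st = m * ∑ j ∈ Finset.range k, gain k q j := by
    simp [PhaseState.target, st, PhaseState.start]
  have hle : ∀ ω, m * ∑ j ∈ Finset.range k, gain k q j ≤
      PhaseState.average (k * m) st fun l => cost C₀ ((R.alg ω).runFrom C₀ [] l) := by
    intro ω
    have := (PhaseState.target_le_average (R.alg ω) C₀ (k * m) m st hn [] C₀).2 C₀ hC₀
    rwa [stepCost_self, zero_add, htarget] at this
  have hmean := integral_mono (integrable_const _)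
    (PhaseState.integrable_average (k * m) st hint) hle
  rw [PhaseState.integral_average _ _ hint, integral_const, probReal_univ, one_smul] at hmean
  obtain ⟨l, hl, hcost⟩ := PhaseState.exists_isOutcome_of_le_average hmean
  obtain ⟨S, hS, hopt⟩ := (PhaseState.exists_solution (k * m) m st hn
    ⟨fun h => by simp [st, PhaseState.start] at h, fun i hi => by simp [st, PhaseState.start] at hi,
      fun i hi => by simp [st, PhaseState.start] at hi⟩ l hl (Equiv.refl _)).1 rfl
  exact ⟨⟨C₀, l⟩, (optCost_le (I := ⟨C₀, l⟩) hS).trans hopt, hcost⟩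

theorem exists_lt_sum_gain {k : ℕ} (hk : 1 ≤ k) {c : ℝ}
    (hc : c < (k : ℝ) + (harmonic k : ℝ) - 1) :
    ∃ q, c < ∑ j ∈ Finset.range k, gain k q j := by
  obtain ⟨k, rfl⟩ := Nat.exists_eq_add_of_le' hk
  set δ := ((k + 1 : ℕ) : ℝ) + (harmonic (k + 1) : ℝ) - 1 - c with hδ
  have hδ0 : 0 < δ := by linarith
  obtain ⟨q, hq⟩ := exists_nat_gt (k * (2 * ((k + 1 : ℕ) : ℝ)) / δ)
  refine ⟨q, ?_⟩
  rw [sum_gain]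
  rw [div_lt_iff₀ hδ0] at hq
  have hq1 : (0 : ℝ) < (q : ℝ) + 1 := by positivity
  have : k * (2 * (((k + 1 : ℕ) : ℝ) / ((q : ℝ) + 1))) < δ := by
    rw [← mul_div_assoc, ← mul_div_assoc, div_lt_iff₀ hq1]
    nlinarith
  linarith

end KServer

theorem mainTheorem1 (k : ℕ) (hk : 1 ≤ k) (c : ℝ) (hc : c < (k : ℝ) + (harmonic k : ℝ) - 1) :
    ∃ (M : Type) (_ : MetricSpace M) (_ : Finite M) (G : SimpleGraph M),
      G.Connected ∧ (∀ x y : M, dist x y = (G.dist x y : ℝ)) ∧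
        ∀ R : KServer.RandomizedOnlineAlgorithm.{0, v} M k,
          ¬ R.IsCompetitiveInExpectation c := by
  have : NeZero k := ⟨by omega⟩
  -- A negative `c` would turn the upper bound on the optimal cost around.
  have hc' : max c 0 < (k : ℝ) + (harmonic k : ℝ) - 1 := by
    refine max_lt hc ?_
    have h1 : (1 : ℝ) ≤ k := by exact_mod_cast hk
    have h2 : (0 : ℝ) < (harmonic k : ℝ) := by exact_mod_cast harmonic_pos (by omega)
    linarith
  obtain ⟨q, hq⟩ := KServer.exists_lt_sum_gain hk hc'
  refine ⟨KServer.Vertex k q, inferInstance, inferInstance, KServer.Vertex.graph k q,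
    KServer.Vertex.connected_graph, KServer.Vertex.dist_eq, ?_⟩
  rintro R ⟨α, hR⟩
  obtain ⟨m, hm⟩ := exists_nat_gt (α / (∑ j ∈ Finset.range k, KServer.gain k q j - max c 0))
  rw [div_lt_iff₀ (by linarith)] at hm
  obtain ⟨I, hopt, hcost⟩ := R.exists_instance m fun I => (hR I).1
  have h1 := (hR I).2
  have h2 : c * KServer.optCost I ≤ max c 0 * m :=
    mul_le_mul (le_max_left _ _) hopt (KServer.optCost_nonneg I) (le_max_right _ _)
  linarith
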